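/- A rooted forest on $[n]=\{1,\dots,n\}$ is an acyclic graph with vertex set $[n]$ together with the choice of one vertex, the root, in each of its connected components. A vertex $v$ of a rooted forest is a record if its label is the largest among all labels on the unique path from the root of its component to $v$ (both end points included; in particular every root is a record). For integers $n,k\ge 0$ let $R(n,k)$ be the number of rooted forests on $[n]$ with exactly $k$ records (so $R(0,0)=1$, counting the empty forest). Theorem. For all integers $n,k\ge 0$, $$R(n,k)=\sum_{m=k+1}^{n+1}(-1)^{m+k-1}\binom{n}{m-1}\,m\,(n+1)^{n-m}\,c(m,m-k),$$ where $c(\cdot,\cdot)$ denotes the unsigned Stirling numbers of the first kind. Here the identity is one of rational numbers (for $m=n+1$ the power is $(n+1)^{-1}$), and the empty sum, which occurs for $k>n$, is $0$. -/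

import Mathlib

/-- A rooted forest on the vertex set `V`: an acyclic simple graph on `V` together with a set of
roots that contains exactly one vertex of each connected component (each component being a
rooted tree). -/
@[ext]
structure RootedForest (V : Type*) where
  /-- the underlying graph -/
  graph : SimpleGraph V
  /-- the set of roots of the trees of the forest -/
  roots : Set V
  isAcyclic : graph.IsAcyclic
  existsUnique_root : ∀ c : graph.ConnectedComponent, ∃! r : V, r ∈ roots ∧ r ∈ c.supp

namespace RootedForest

instance {V : Type*} [Finite V] : Finite (RootedForest V) :=
  Finite.of_injective (fun F : RootedForest V => (F.graph, F.roots)) fun _ _ h =>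
    RootedForest.ext (Prod.mk.inj h).1 (Prod.mk.inj h).2

/-- A vertex `v` is a record if its label is the largest along the (unique) path joining the root
of its tree to `v`; both end points of the path are included. -/
def IsRecord {V : Type*} [LinearOrder V] (F : RootedForest V) (v : V) : Prop :=
  ∃ r ∈ F.roots, ∃ p : F.graph.Walk r v, p.IsPath ∧ ∀ w ∈ p.support, w ≤ v

/-- The number of records of a rooted forest. -/
noncomputable def numRecords {V : Type*} [LinearOrder V] (F : RootedForest V) : ℕ :=
  {v : V | F.IsRecord v}.ncard

end RootedForest

/-- The forest record number `R(n, k)`: the number of rooted forests on `n` vertices, labelled by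
the linearly ordered set `Fin n`, that have exactly `k` records. -/
noncomputable def forestRecordNumber (n k : ℕ) : ℕ :=
  Nat.card {F : RootedForest (Fin n) // F.numRecords = k}

/-! Encode a rooted forest by its well-founded parent function and let F_n(x) = Σ x^(number of
records). Remove the largest of n + 1 vertices. The s vertices not descending from it form a forest
A, its proper descendants form a forest B, and its parent is one of the s vertices of A, or it is a
root. The largest vertex is a record, its proper descendants never are, and records of A stay
records. Hence F_{n+1}(x) = x Σ_s C(n,s) (s+1) F_s(x) F_{n-s}(1) (`recordSum_fin_succ`).

At x = 1, Abel's binomial identity gives Cayley's F_n(1) = (n+1)^(n-1). With P_j = ∏_{i=1}^{j} (ix -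
1), the recursion and Abel's identity then give (n+1) F_n(x) = Σ_j C(n,j) (j+1) (n+1)^(n-j) P_j
(`recordSum_fin`). The coefficients of P_j are signed Stirling numbers (`coeff_prod`); the theorem
is the coefficient of x^k, with m = j + 1. -/

open Relation

/-! ### Parent maps and rooted forests -/

/-- A parent map on `V` sends every vertex to its parent (or to `none`), in such a way that
following parents always terminates. -/
structure ParentMap (V : Type*) where
  /-- the parent of a vertex -/
  parent : V → Option V
  wf : WellFounded fun x y => parent y = some x

namespace ParentMap

variable {V W : Type*}

theorem parent_injective : Function.Injective (parent : ParentMap V → V → Option V) := by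
  rintro ⟨f, _⟩ ⟨g, _⟩ h
  cases h
  rfl

instance [Finite V] : Finite (ParentMap V) := Finite.of_injective _ parent_injective

noncomputable instance [Finite V] : Fintype (ParentMap V) := Fintype.ofFinite _

@[ext]
theorem ext {f g : ParentMap V} (h : ∀ v, f.parent v = g.parent v) : f = g :=
  parent_injective (funext h)

/-- `f.Anc v w` means that `w` is reached from `v` by following parents. -/
def Anc (f : ParentMap V) (v w : V) : Prop :=
  ReflTransGen (fun x y => f.parent x = some y) v w

theorem not_transGen_self (f : ParentMap V) (v : V) :
    ¬ TransGen (fun x y => f.parent x = some y) v v := by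
  intro h
  have h' : TransGen (fun x y => f.parent y = some x) v v := transGen_swap.2 h
  exact f.wf.transGen.irrefl.irrefl v h'

theorem Anc.parent {f : ParentMap V} {u v w : V} (h : f.Anc u w) (huv : f.parent u = some v)
    (hne : u ≠ w) : f.Anc v w := by
  rcases h.cases_head with rfl | ⟨x, hx, hxw⟩
  · exact absurd rfl hne
  · rw [huv] at hx
    cases hx
    exact hxw

theorem ne_of_parent (f : ParentMap V) {u v : V} (h : f.parent u = some v) : u ≠ v := by
  rintro rfl
  exact f.not_transGen_self _ (.single h)

/-- The graph joining every vertex to its parent. -/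
def graph (f : ParentMap V) : SimpleGraph V where
  Adj u v := f.parent u = some v ∨ f.parent v = some u
  symm := ⟨fun _ _ h => h.symm⟩
  loopless := ⟨fun _ h => f.ne_of_parent (h.elim id id) rfl⟩

theorem mem_of_reachable {G : SimpleGraph V} {s : Set V} (hs : ∀ ⦃x y⦄, G.Adj x y → x ∈ s → y ∈ s)
    {u v : V} (h : G.Reachable u v) (hu : u ∈ s) : v ∈ s := by
  obtain ⟨p⟩ := h
  induction p with
  | nil => exact hu
  | cons hadj _ ih => exact ih (hs hadj hu)

/-- The set of descendants of `u`, including `u`, is closed under adjacency once the edge to its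
parent `v` is deleted. If `v` were still reachable it would descend from `u`, giving a cycle of
parents. -/
theorem not_reachable_deleteEdges_parent (f : ParentMap V) {u v : V} (h : f.parent u = some v) :
    ¬ (f.graph.deleteEdges {s(u, v)}).Reachable u v := by
  intro hr
  have hv : f.Anc v u := by
    refine mem_of_reachable (s := {w | f.Anc w u}) ?_ hr ReflTransGen.refl
    intro x y hxy hx
    rw [SimpleGraph.deleteEdges_adj] at hxy
    obtain ⟨hxy | hyx, hne⟩ := hxy
    · refine Anc.parent hx hxy ?_
      rintro rfl
      rw [h] at hxy
      cases hxy
      exact hne rfl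
    · exact ReflTransGen.head hyx hx
  exact f.not_transGen_self u (TransGen.head' h hv)

theorem graph_isAcyclic (f : ParentMap V) : f.graph.IsAcyclic := by
  rw [SimpleGraph.isAcyclic_iff_forall_adj_isBridge]
  rintro u v (h | h)
  · exact f.not_reachable_deleteEdges_parent h
  · rw [Sym2.eq_swap]
    exact f.not_reachable_deleteEdges_parent h

/-- The chain of parents is a path whose support is the set of ancestors; this links records along
paths to records along ancestors. -/
theorem exists_root_walk (f : ParentMap V) (v : V) :
    ∃ r, f.parent r = none ∧ ∃ p : f.graph.Walk v r, p.IsPath ∧ ∀ w, w ∈ p.support ↔ f.Anc v w := by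
  induction v using f.wf.induction with
  | _ v ih =>
    rcases hv : f.parent v with _ | u
    · refine ⟨v, hv, .nil, .nil, fun w => ?_⟩
      rw [SimpleGraph.Walk.support_nil, List.mem_singleton]
      refine ⟨fun h => h ▸ ReflTransGen.refl, fun h => ?_⟩
      rcases h.cases_head with rfl | ⟨x, hx, -⟩
      · rfl
      · simp [hv] at hx
    · obtain ⟨r, hr, p, hp, hs⟩ := ih u hv
      have hadj : f.graph.Adj v u := Or.inl hv
      refine ⟨r, hr, .cons hadj p, ?_, fun w => ?_⟩
      · rw [SimpleGraph.Walk.cons_isPath_iff, hs]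
        exact ⟨hp, fun h => f.not_transGen_self v (TransGen.head' hv h)⟩
      · rw [SimpleGraph.Walk.support_cons, List.mem_cons, hs]
        constructor
        · rintro (rfl | h)
          · exact ReflTransGen.refl
          · exact ReflTransGen.head hv h
        · intro h
          rcases eq_or_ne v w with rfl | hne
          · exact Or.inl rfl
          · exact Or.inr (h.parent hv hne)

theorem eq_of_reachable_of_parent_eq_none (f : ParentMap V) {r r' : V} (hr : f.parent r = none)
    (hr' : f.parent r' = none) (h : f.graph.Reachable r r') : r' = r := by
  have hanc : f.Anc r' r := by
    refine mem_of_reachable (s := {w | f.Anc w r}) ?_ h ReflTransGen.refl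
    rintro x y (hxy | hyx) hx
    · refine Anc.parent hx hxy ?_
      rintro rfl
      simp [hr] at hxy
    · exact ReflTransGen.head hyx hx
  rcases hanc.cases_head with h | ⟨x, hx, -⟩
  · exact h
  · simp [hr'] at hx

/-- The rooted forest with a given parent map. -/
def toRootedForest (f : ParentMap V) : RootedForest V where
  graph := f.graph
  roots := {v | f.parent v = none}
  isAcyclic := f.graph_isAcyclic
  existsUnique_root c := by
    induction c using SimpleGraph.ConnectedComponent.ind with
    | _ v =>
      obtain ⟨r, hr, p, -⟩ := f.exists_root_walk v
      refine ⟨r, ⟨hr, ?_⟩, ?_⟩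
      · exact SimpleGraph.ConnectedComponent.sound p.reachable.symm
      · rintro r' ⟨hr', hv⟩
        have hv' := SimpleGraph.ConnectedComponent.exact hv
        exact f.eq_of_reachable_of_parent_eq_none hr hr' (p.reachable.symm.trans hv'.symm)

theorem toRootedForest_injective : Function.Injective (toRootedForest (V := V)) := by
  intro f g h
  have hgraph : f.graph = g.graph := congrArg RootedForest.graph h
  have hroots (v : V) : f.parent v = none ↔ g.parent v = none :=
    Set.ext_iff.1 (congrArg RootedForest.roots h) v
  ext1 v
  induction v using f.wf.induction with
  | _ v ih =>
    rcases hv : f.parent v with _ | u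
    · exact ((hroots v).1 hv).symm
    · have hadj : g.graph.Adj v u := hgraph ▸ Or.inl hv
      rcases hadj with h | h
      · exact h.symm
      · rw [← ih u hv] at h
        exact (f.not_transGen_self v (.head hv (.single h))).elim

theorem toRootedForest_surjective : Function.Surjective (toRootedForest (V := V)) := by
  intro F
  choose root hroot huniq using fun v : V => F.existsUnique_root (F.graph.connectedComponentMk v)
  have hreach (v : V) : F.graph.Reachable v (root v) :=
    (SimpleGraph.ConnectedComponent.exact (hroot v).2).symm
  have root_eq {u v : V} (h : F.graph.Reachable u v) : root u = root v := by
    refine huniq v _ ⟨(hroot u).1, ?_⟩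
    exact SimpleGraph.ConnectedComponent.sound ((hreach u).symm.trans h)
  have root_self {v : V} (hv : v ∈ F.roots) : root v = v :=
    (huniq v v ⟨hv, rfl⟩).symm
  -- The parent of a non-root is chosen as a neighbour strictly closer to the root, so the distance
  -- to the root makes the parent map well-founded.
  have hstep (v : V) (hv : v ∉ F.roots) :
      ∃ u, F.graph.Adj v u ∧ F.graph.dist u (root u) < F.graph.dist v (root v) := by
    obtain ⟨p, hp⟩ := (hreach v).exists_walk_length_eq_dist
    have hne : v ≠ root v := fun h => hv (h ▸ (hroot v).1)
    obtain ⟨u, hadj, q, rfl⟩ := SimpleGraph.Walk.exists_eq_cons_of_ne hne p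
    refine ⟨u, hadj, ?_⟩
    rw [← hp, SimpleGraph.Walk.length_cons, ← root_eq hadj.reachable]
    exact Nat.lt_succ_of_le (SimpleGraph.dist_le q)
  choose! par hadj hlt using hstep
  classical
  let f : ParentMap V := ⟨fun v => if v ∈ F.roots then none else some (par v), by
    refine Subrelation.wf ?_ (measure fun v => F.graph.dist v (root v)).wf
    intro x y h
    by_cases hy : y ∈ F.roots
    · simp [hy] at h
    · simp only [hy, if_false, Option.some.injEq] at h
      exact h ▸ hlt y hy⟩
  have hroots (v : V) : f.parent v = none ↔ v ∈ F.roots := by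
    by_cases hv : v ∈ F.roots <;> simp [f, hv]
  have hpar {u v : V} (h : f.parent u = some v) : F.graph.Adj u v := by
    by_cases hu : u ∈ F.roots
    · simp [f, hu] at h
    · simp only [f, hu, if_false, Option.some.injEq] at h
      exact h ▸ hadj u hu
  have hle : f.graph ≤ F.graph := by
    rintro u v (h | h)
    · exact hpar h
    · exact (hpar h).symm
  have hfreach (v : V) : f.graph.Reachable v (root v) := by
    obtain ⟨r, hr, p, -⟩ := f.exists_root_walk v
    have : root v = r := by
      rw [root_eq (p.reachable.mono hle), root_self ((hroots r).1 hr)]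
    exact this ▸ p.reachable
  refine ⟨f, RootedForest.ext (le_antisymm hle ?_) (Set.ext hroots)⟩
  intro u v huv
  by_contra hnot
  -- An edge of `F` that joins no vertex to its parent would not be a bridge: its ends stay
  -- connected through the root by parent edges.
  refine SimpleGraph.isAcyclic_iff_forall_adj_isBridge.1 F.isAcyclic huv ?_
  have huv' : f.graph.Reachable u v :=
    (hfreach u).trans (root_eq huv.reachable ▸ (hfreach v).symm)
  refine huv'.mono fun x y hxy => ?_
  rw [SimpleGraph.deleteEdges_adj]
  refine ⟨hle hxy, fun he => hnot ?_⟩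
  rw [Set.mem_singleton_iff, Sym2.eq_iff] at he
  rcases he with ⟨rfl, rfl⟩ | ⟨rfl, rfl⟩
  · exact hxy
  · exact hxy.symm

/-! ### Records and relabelling -/

section Records

variable [LinearOrder V] [LinearOrder W]

/-- A vertex is a record of a parent map if it is the largest of its ancestors. -/
def IsRecord (f : ParentMap V) (v : V) : Prop := ∀ w, f.Anc v w → w ≤ v

/-- The number of records of a parent map. -/
noncomputable def numRecords (f : ParentMap V) : ℕ := {v : V | f.IsRecord v}.ncard

theorem isRecord_toRootedForest (f : ParentMap V) (v : V) :
    f.toRootedForest.IsRecord v ↔ f.IsRecord v := by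
  obtain ⟨r, hr, p, hp, hs⟩ := f.exists_root_walk v
  have hrev {w : V} : w ∈ p.reverse.support ↔ f.Anc v w := by
    rw [SimpleGraph.Walk.support_reverse, List.mem_reverse, hs]
  constructor
  · rintro ⟨r', hr', q, hq, hmax⟩ w hw
    have hrr : r' = r := f.eq_of_reachable_of_parent_eq_none hr hr'
      (p.reachable.symm.trans (SimpleGraph.Walk.reachable q).symm)
    subst hrr
    have := f.graph_isAcyclic.subsingleton_path r' v
    have hpq : p.reverse = q :=
      congrArg Subtype.val (Subsingleton.elim (⟨p.reverse, hp.reverse⟩ : f.graph.Path r' v) ⟨q, hq⟩)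
    refine hmax w ?_
    rw [← hpq]
    exact hrev.2 hw
  · intro h
    refine ⟨r, hr, p.reverse, hp.reverse, fun w hw => h w (hrev.1 hw)⟩

theorem numRecords_toRootedForest (f : ParentMap V) :
    f.toRootedForest.numRecords = f.numRecords := by
  simp only [RootedForest.numRecords, numRecords, isRecord_toRootedForest]

/-- Relabelling the vertices of a parent map. -/
def map (e : V ≃o W) (f : ParentMap V) : ParentMap W :=
  ⟨fun w => (f.parent (e.symm w)).map e, by
    refine Subrelation.wf ?_ (InvImage.wf e.symm f.wf)
    intro x y h
    obtain ⟨a, ha, rfl⟩ := Option.map_eq_some_iff.1 h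
    simpa [InvImage] using ha⟩

theorem map_symm_map (e : V ≃o W) (f : ParentMap V) : (f.map e).map e.symm = f := by
  ext1 v
  simp [map, Function.comp_def]

/-- Relabelling as an equivalence. -/
def mapEquiv (e : V ≃o W) : ParentMap V ≃ ParentMap W where
  toFun := map e
  invFun := map e.symm
  left_inv := map_symm_map e
  right_inv := map_symm_map e.symm

theorem Anc.map (e : V ≃o W) {f : ParentMap V} {v w : V} (h : f.Anc v w) :
    (f.map e).Anc (e v) (e w) :=
  ReflTransGen.lift e (p := fun x y => (f.map e).parent x = some y)
    (fun a b (hab : f.parent a = some b) => by simp [Function.onFun, ParentMap.map, hab]) v w h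

theorem IsRecord.of_map (e : V ≃o W) {f : ParentMap V} {v : V} (h : (f.map e).IsRecord (e v)) :
    f.IsRecord v :=
  fun _ hw => e.le_iff_le.1 (h _ (hw.map e))

theorem isRecord_map (e : V ≃o W) (f : ParentMap V) (v : V) :
    (f.map e).IsRecord (e v) ↔ f.IsRecord v := by
  refine ⟨IsRecord.of_map e, fun h => IsRecord.of_map e.symm ?_⟩
  rwa [map_symm_map, OrderIso.symm_apply_apply]

theorem numRecords_map (e : V ≃o W) (f : ParentMap V) : (f.map e).numRecords = f.numRecords := by
  have : {w : W | (f.map e).IsRecord w} = e '' {v : V | f.IsRecord v} := by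
    ext w
    obtain ⟨v, rfl⟩ := e.surjective w
    simp [isRecord_map]
  rw [numRecords, this, Set.ncard_image_of_injective _ e.injective, numRecords]

end Records

end ParentMap

namespace ParentMap

/-! ### Removing the largest vertex -/

section Glue

theorem coe_coe_injective {U : Type*} (S : Finset U) :
    Function.Injective fun s : S => ((s : U) : WithTop U) :=
  fun _ _ h => Subtype.ext (WithTop.coe_injective h)

theorem glue_cases {U : Type*} (S : Finset U) (v : WithTop U) :
    v = ⊤ ∨ (∃ s : S, v = ((s : U) : WithTop U)) ∨ ∃ t : {u // u ∉ S}, v = ((t : U) : WithTop U) := by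
  induction v using WithTop.recTopCoe with
  | top => exact Or.inl rfl
  | coe u =>
    by_cases h : u ∈ S
    · exact Or.inr (Or.inl ⟨⟨u, h⟩, rfl⟩)
    · exact Or.inr (Or.inr ⟨⟨u, h⟩, rfl⟩)

variable {U : Type*} [LinearOrder U] {S : Finset U}

/-- The parent function obtained from parent maps `a` on `S` and `b` on the complement of `S` by
adding a largest vertex whose parent is `o` and making it the parent of all roots of `b`. -/
def glueParent (a : ParentMap S) (b : ParentMap {u // u ∉ S}) (o : Option S) :
    WithTop U → Option (WithTop U) := fun v =>
  WithTop.recTopCoe (C := fun _ => Option (WithTop U)) (o.map fun s : S => ((s : U) : WithTop U))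
    (fun u => if h : u ∈ S then (a.parent ⟨u, h⟩).map fun s : S => ((s : U) : WithTop U)
      else some ((b.parent ⟨u, h⟩).elim ⊤ fun t => ((t : U) : WithTop U))) v

variable (a : ParentMap S) (b : ParentMap {u // u ∉ S}) (o : Option S)

@[simp]
theorem glueParent_top : glueParent a b o ⊤ = o.map fun s : S => ((s : U) : WithTop U) := rfl

@[simp]
theorem glueParent_coe (s : S) :
    glueParent a b o ((s : U) : WithTop U) =
      (a.parent s).map fun s : S => ((s : U) : WithTop U) := by
  simp [glueParent]

@[simp]
theorem glueParent_coe_compl (t : {u // u ∉ S}) :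
    glueParent a b o ((t : U) : WithTop U) =
      some ((b.parent t).elim ⊤ fun t => ((t : U) : WithTop U)) := by
  simp [glueParent, t.2]

/-- Chains of parents starting in `S` stay in `S`, those from `⊤` enter `S` or stop, and those from
the complement reach `⊤`; accessibility is proved in this order. -/
theorem glueParent_wf : WellFounded fun x y => glueParent a b o y = some x := by
  have hS (s : S) : Acc (fun x y => glueParent a b o y = some x) ((s : U) : WithTop U) := by
    induction s using a.wf.induction with
    | _ s ih =>
      refine ⟨_, fun y hy => ?_⟩
      rw [glueParent_coe] at hy
      obtain ⟨s', hs', rfl⟩ := Option.map_eq_some_iff.1 hy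
      exact ih s' hs'
  have htop : Acc (fun x y => glueParent a b o y = some x) ⊤ := by
    refine ⟨_, fun y hy => ?_⟩
    rw [glueParent_top] at hy
    obtain ⟨s', hs', rfl⟩ := Option.map_eq_some_iff.1 hy
    exact hS s'
  have hT (t : {u // u ∉ S}) :
      Acc (fun x y => glueParent a b o y = some x) ((t : U) : WithTop U) := by
    induction t using b.wf.induction with
    | _ t ih =>
      refine ⟨_, fun y hy => ?_⟩
      rw [glueParent_coe_compl] at hy
      cases ht : b.parent t with
      | none =>
        simp only [ht, Option.elim_none, Option.some.injEq] at hy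
        exact hy ▸ htop
      | some t' =>
        simp only [ht, Option.elim_some, Option.some.injEq] at hy
        exact hy ▸ ih t' ht
  refine ⟨fun v => ?_⟩
  rcases glue_cases S v with rfl | ⟨s, rfl⟩ | ⟨t, rfl⟩
  exacts [htop, hS s, hT t]

/-- The parent map obtained from parent maps `a` on `S` and `b` on the complement of `S` by
adding a largest vertex whose parent is `o` and making it the parent of all roots of `b`. -/
@[simps]
def glue : ParentMap (WithTop U) where
  parent := glueParent a b o
  wf := glueParent_wf a b o

theorem anc_glue_coe_iff {s : S} {w : WithTop U} :
    (glue a b o).Anc ((s : U) : WithTop U) w ↔ ∃ s' : S, w = ((s' : U) : WithTop U) ∧ a.Anc s s' := by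
  constructor
  · intro h
    induction h with
    | refl => exact ⟨s, rfl, ReflTransGen.refl⟩
    | tail _ h ih =>
      obtain ⟨s', rfl, hs'⟩ := ih
      rw [glue_parent, glueParent_coe] at h
      obtain ⟨s'', hs'', rfl⟩ := Option.map_eq_some_iff.1 h
      exact ⟨s'', rfl, hs'.tail hs''⟩
  · rintro ⟨s', rfl, h⟩
    exact ReflTransGen.lift (p := fun x y => (glue a b o).parent x = some y)
      (fun s : S => ((s : U) : WithTop U))
      (fun x y (hxy : a.parent x = some y) => by simp [Function.onFun, hxy]) s s' h

theorem anc_glue_coe_compl_top (t : {u // u ∉ S}) :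
    (glue a b o).Anc ((t : U) : WithTop U) ⊤ := by
  induction t using b.wf.induction with
  | _ t ih =>
    cases ht : b.parent t with
    | none => exact ReflTransGen.single (by simp [ht])
    | some t' => exact ReflTransGen.head (by simp [ht]) (ih t' ht)

/-- Recovers `S` from the glued map, as injectivity of gluing requires. -/
theorem mem_iff_not_anc_glue_top (u : U) : u ∈ S ↔ ¬ (glue a b o).Anc (u : WithTop U) ⊤ := by
  constructor
  · intro h hanc
    obtain ⟨s', hs', -⟩ := (anc_glue_coe_iff a b o (s := ⟨u, h⟩)).1 hanc
    exact WithTop.top_ne_coe hs'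
  · intro h
    by_contra hu
    exact h (anc_glue_coe_compl_top a b o ⟨u, hu⟩)

theorem isRecord_glue_coe_iff (s : S) :
    (glue a b o).IsRecord ((s : U) : WithTop U) ↔ a.IsRecord s := by
  constructor
  · intro h s' hs'
    have := h _ ((anc_glue_coe_iff a b o).2 ⟨s', rfl, hs'⟩)
    exact Subtype.coe_le_coe.1 (WithTop.coe_le_coe.1 this)
  · intro h w hw
    obtain ⟨s', rfl, hs'⟩ := (anc_glue_coe_iff a b o).1 hw
    exact WithTop.coe_le_coe.2 (h s' hs')

theorem setOf_isRecord_glue : {v | (glue a b o).IsRecord v} =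
    insert ⊤ ((fun s : S => ((s : U) : WithTop U)) '' {s | a.IsRecord s}) := by
  ext v
  simp only [Set.mem_ofPred_eq, Set.mem_insert_iff, Set.mem_image]
  constructor
  · intro h
    rcases glue_cases S v with rfl | ⟨s, rfl⟩ | ⟨t, rfl⟩
    · exact Or.inl rfl
    · exact Or.inr ⟨s, (isRecord_glue_coe_iff a b o s).1 h, rfl⟩
    · exact absurd (top_le_iff.1 (h _ (anc_glue_coe_compl_top a b o t))) (WithTop.coe_ne_top)
  · rintro (rfl | ⟨s, hs, rfl⟩)
    · exact fun _ _ => le_top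
    · exact (isRecord_glue_coe_iff a b o s).2 hs

theorem numRecords_glue : (glue a b o).numRecords = a.numRecords + 1 := by
  rw [numRecords, setOf_isRecord_glue, Set.ncard_insert_of_notMem _ (Set.toFinite _),
    Set.ncard_image_of_injective _ (coe_coe_injective S), numRecords]
  rintro ⟨s, -, hs⟩
  exact WithTop.coe_ne_top hs

variable (U) in
/-- The data from which parent maps on `WithTop U` are glued. -/
abbrev GlueData : Type _ :=
  Σ S : Finset U, ParentMap S × ParentMap {u // u ∉ S} × Option S

theorem glue_injective :
    Function.Injective fun d : GlueData U => glue d.2.1 d.2.2.1 d.2.2.2 := by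
  rintro ⟨S, a, b, o⟩ ⟨S', a', b', o'⟩ h
  simp only at h
  have hS : S = S' := by
    ext u
    rw [mem_iff_not_anc_glue_top a b o, mem_iff_not_anc_glue_top a' b' o', h]
  subst hS
  have hpar (v : WithTop U) : glueParent a b o v = glueParent a' b' o' v :=
    congrFun (congrArg parent h) v
  have ho : o = o' := by
    have := hpar ⊤
    rw [glueParent_top, glueParent_top] at this
    exact Option.map_injective (coe_coe_injective S) this
  have ha : a = a' := by
    ext1 s
    have := hpar ((s : U) : WithTop U)
    rw [glueParent_coe, glueParent_coe] at this
    exact Option.map_injective (coe_coe_injective S) this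
  have hb : b = b' := by
    ext1 t
    have := hpar ((t : U) : WithTop U)
    rw [glueParent_coe_compl, glueParent_coe_compl] at this
    cases ht : b.parent t <;> cases ht' : b'.parent t <;> simp_all [Subtype.ext_iff]
  rw [ha, hb, ho]

theorem glue_surjective [Fintype U] :
    Function.Surjective fun d : GlueData U => glue d.2.1 d.2.2.1 d.2.2.2 := by
  classical
  intro f
  let S : Finset U := {u : U | ¬ f.Anc (u : WithTop U) ⊤}
  have hmem (u : U) : u ∈ S ↔ ¬ f.Anc (u : WithTop U) ⊤ := by simp [S]
  -- `TransGen` rather than `Anc` lets this apply to `v = ⊤` too, where acyclicity supplies the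
  -- hypothesis.
  have hup {v w : WithTop U} (hv : ¬ TransGen (fun x y => f.parent x = some y) v ⊤)
      (h : f.parent v = some w) : ∃ s : S, w = ((s : U) : WithTop U) := by
    induction w using WithTop.recTopCoe with
    | top => exact absurd (.single h) hv
    | coe u => exact ⟨⟨u, (hmem u).2 fun hu => hv (.head' h hu)⟩, rfl⟩
  have hlift {v : WithTop U} (hv : ¬ TransGen (fun x y => f.parent x = some y) v ⊤) :
      ∃ o : Option S, o.map (fun s : S => ((s : U) : WithTop U)) = f.parent v := by
    cases h : f.parent v with
    | none => exact ⟨none, rfl⟩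
    | some w =>
      obtain ⟨s, rfl⟩ := hup hv h
      exact ⟨some s, rfl⟩
  obtain ⟨o, ho⟩ := hlift (f.not_transGen_self ⊤)
  choose a ha using fun s : S => hlift fun h => (hmem s).1 s.2 h.to_reflTransGen
  have hdown (t : {u // u ∉ S}) : ∃ q : Option {u // u ∉ S},
      some (q.elim ⊤ fun t => ((t : U) : WithTop U)) = f.parent ((t : U) : WithTop U) := by
    have ht : f.Anc ((t : U) : WithTop U) ⊤ := not_not.1 fun h => t.2 ((hmem _).2 h)
    rcases ht.cases_head with h | ⟨w, hw, hwt⟩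
    · exact absurd h WithTop.coe_ne_top
    · induction w using WithTop.recTopCoe with
      | top => exact ⟨none, hw.symm⟩
      | coe u => exact ⟨some ⟨u, fun hu => (hmem u).1 hu hwt⟩, hw.symm⟩
  choose b hb using hdown
  have hawf : WellFounded fun x y => a y = some x := by
    refine Subrelation.wf ?_ (InvImage.wf (fun s : S => ((s : U) : WithTop U)) f.wf)
    intro x y h
    simp [InvImage, ← ha, h]
  have hbwf : WellFounded fun x y => b y = some x := by
    refine Subrelation.wf ?_ (InvImage.wf (fun t : {u // u ∉ S} => ((t : U) : WithTop U)) f.wf)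
    intro x y h
    simp [InvImage, ← hb, h]
  refine ⟨⟨S, ⟨a, hawf⟩, ⟨b, hbwf⟩, o⟩, ext fun v => ?_⟩
  rcases glue_cases S v with rfl | ⟨s, rfl⟩ | ⟨t, rfl⟩
  · exact ho
  · rw [glue_parent, glueParent_coe]
    exact ha s
  · rw [glue_parent, glueParent_coe_compl]
    exact hb t

end Glue

/-! ### Recursion for the record generating function -/

section RecordSum

variable {R : Type*} [CommSemiring R]

/-- The generating function of the number of records of parent maps on `V`. -/
noncomputable def recordSum (V : Type*) [Finite V] [LinearOrder V] (x : R) : R :=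
  ∑ f : ParentMap V, x ^ f.numRecords

theorem recordSum_congr {V W : Type*} [Finite V] [Finite W] [LinearOrder V] [LinearOrder W]
    (e : V ≃o W) (x : R) : recordSum V x = recordSum W x :=
  Fintype.sum_equiv (mapEquiv e) _ _ fun f => by rw [← numRecords_map e f]; rfl

theorem recordSum_eq_of_card_eq {V : Type*} [Fintype V] [LinearOrder V] {n : ℕ}
    (h : Fintype.card V = n) (x : R) : recordSum V x = recordSum (Fin n) x :=
  (recordSum_congr (monoEquivOfFin V h) x).symm

/-- The factor `x` is the record `⊤`. The forest below it contributes no records, hence the argument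
`1`, and `S.card + 1` counts the choices of a parent for `⊤`. -/
theorem recordSum_withTop (U : Type*) [Fintype U] [LinearOrder U] (x : R) :
    recordSum (WithTop U) x = ∑ S : Finset U,
      x * (recordSum S x * recordSum {u // u ∉ S} (1 : R) * ((S.card : R) + 1)) := by
  classical
  rw [recordSum, ← Function.Bijective.sum_comp ⟨glue_injective, glue_surjective⟩,
    Fintype.sum_sigma]
  refine Finset.sum_congr rfl fun S _ => ?_
  simp only [numRecords_glue, Fintype.sum_prod_type, Finset.sum_const, Finset.card_univ,
    Fintype.card_prod, Fintype.card_option, Fintype.card_coe, recordSum, one_pow, nsmul_eq_mul, ← Finset.mul_sum,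
    pow_succ, ← Finset.sum_mul]
  push_cast
  ring

theorem recordSum_fin_zero (x : R) : recordSum (Fin 0) x = 1 := by
  have : Unique (ParentMap (Fin 0)) :=
    { default := ⟨fun v => v.elim0, ⟨fun v => v.elim0⟩⟩
      uniq := fun f => ext fun v => v.elim0 }
  have h (f : ParentMap (Fin 0)) : f.numRecords = 0 := by
    rw [numRecords, Set.eq_empty_of_isEmpty {v | f.IsRecord v}, Set.ncard_empty]
  simp [recordSum, h]

theorem recordSum_fin_succ (n : ℕ) (x : R) :
    recordSum (Fin (n + 1)) x = ∑ p ∈ Finset.HasAntidiagonal.antidiagonal n, (n.choose p.1 : R) *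
      (x * (recordSum (Fin p.1) x * recordSum (Fin p.2) (1 : R) * ((p.1 : R) + 1))) := by
  have hcard : Fintype.card (WithTop (Fin n)) = n + 1 := by
    rw [show Fintype.card (WithTop (Fin n)) = Fintype.card (Option (Fin n)) from rfl,
      Fintype.card_option, Fintype.card_fin]
  rw [← recordSum_eq_of_card_eq hcard, recordSum_withTop,
    Finset.Nat.sum_antidiagonal_eq_sum_range_succ_mk, ← Finset.powerset_univ]
  have h := Finset.sum_powerset_apply_card (x := (Finset.univ : Finset (Fin n))) fun s =>
    x * (recordSum (Fin s) x * recordSum (Fin (n - s)) (1 : R) * ((s : R) + 1))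
  simp only [Finset.card_univ, Fintype.card_fin, nsmul_eq_mul] at h
  rw [Nat.succ_eq_add_one, ← h]
  refine Finset.sum_congr rfl fun S _ => ?_
  rw [recordSum_eq_of_card_eq (V := S) (Fintype.card_coe S),
    recordSum_eq_of_card_eq (V := {u // u ∉ S}) (n := n - S.card)]
  rw [Fintype.card_subtype_compl, Fintype.card_fin, Fintype.card_coe]

end RecordSum

end ParentMap
-- Abel's binomial identity
open Finset Polynomial

theorem Polynomial.eq_of_derivative_eq_of_eval_eq {R : Type*} [CommRing R] [IsAddTorsionFree R]
    {p q : R[X]} (a : R) (h : derivative p = derivative q) (ha : p.eval a = q.eval a) : p = q := by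
  have h0 : derivative (p - q) = 0 := by rw [derivative_sub, h, sub_self]
  obtain ⟨c, hc⟩ := natDegree_eq_zero.1 (derivative_eq_zero.1 h0)
  have hc0 : c = 0 := by
    have := congrArg (eval a) hc
    rwa [eval_C, eval_sub, ha, sub_self] at this
  rw [hc0, map_zero] at hc
  exact sub_eq_zero.1 hc.symm

/-- The special case `a = 1` of the binomial identity of Abel. -/
theorem sum_antidiagonal_choose_mul_pow (N : ℕ) (y : ℚ) :
    ∑ p ∈ antidiagonal N, (N.choose p.1 : ℚ) * (y + p.1) ^ p.1 * ((p.2 : ℚ) + 1) ^ (p.2 - 1) =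
      (y + 1 + N) ^ N := by
  suffices h : ∀ N : ℕ, ∑ p ∈ antidiagonal N, C ((N.choose p.1 : ℚ) * ((p.2 : ℚ) + 1) ^ (p.2 - 1)) *
      (X + C (p.1 : ℚ)) ^ p.1 = (X + C ((N : ℚ) + 1)) ^ N by
    have := congrArg (Polynomial.eval y) (h N)
    simp only [eval_finsetSum, eval_mul, eval_C, eval_pow, eval_add, eval_X] at this
    rw [add_assoc, add_comm 1 (N : ℚ), ← this]
    exact sum_congr rfl fun p _ => by ring
  intro N
  induction N with
  | zero => simp
  | succ N ih =>
    -- The derivatives agree by the induction hypothesis shifted by 1. At -(N+2) the right side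
    -- vanishes, and the left is the (N+1)-st finite difference of y^N at 1.
    refine eq_of_derivative_eq_of_eval_eq (-((N : ℚ) + 2)) ?_ ?_
    · have h := congrArg (fun p => C ((N : ℚ) + 1) * p.comp (X + 1)) ih
      simp only [Polynomial.sum_comp, mul_comp, pow_comp, add_comp, X_comp, C_comp, mul_sum] at h
      simp only [derivative_sum, derivative_C_mul, derivative_X_add_C_pow]
      rw [Nat.sum_antidiagonal_succ]
      simp only [Nat.cast_zero, map_zero, zero_mul, mul_zero, zero_add]
      convert h using 1
      · refine sum_congr rfl fun p _ => ?_
        have hc : ((N + 1).choose (p.1 + 1) : ℚ) * (p.1 + 1) = (N + 1) * N.choose p.1 := by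
          exact_mod_cast (Nat.add_one_mul_choose_eq N p.1).symm
        have hc' := congrArg (C : ℚ →+* ℚ[X]) hc
        simp only [map_mul, map_add, map_natCast, map_one, Nat.cast_add, Nat.cast_one,
          Nat.add_sub_cancel] at hc' ⊢
        linear_combination (C (((p.2 : ℚ) + 1) ^ (p.2 - 1)) * (X + ((p.1 : ℚ[X]) + 1)) ^ p.1) * hc'
      · simp only [map_add, map_natCast, map_one, Nat.cast_add, Nat.cast_one, Nat.add_sub_cancel]
        ring
    · simp only [eval_finsetSum, eval_mul, eval_C, eval_pow, eval_add, eval_X]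
      have h := congrFun (fwdDiff_iter_pow_eq_zero_of_lt (R := ℚ) (Nat.lt_succ_self N)) 1
      rw [fwdDiff_iter_eq_sum_shift, Pi.zero_apply, ← sum_range_reflect] at h
      rw [Nat.sum_antidiagonal_eq_sum_range_succ_mk]
      push_cast
      rw [show -((N : ℚ) + 2) + (N + 1 + 1) = 0 by ring, zero_pow N.succ_ne_zero, ← h]
      refine sum_congr rfl fun s hs => ?_
      have hs' : s ≤ N + 1 := Nat.lt_succ_iff.1 (mem_range.1 hs)
      obtain ⟨t, ht⟩ := Nat.exists_eq_add_of_le hs'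
      have h1 : N + 1 - s = t := by omega
      have h2 : N + 1 + 1 - 1 - s = t := by omega
      have h3 : N + 1 - t = s := by omega
      have h4 : (N : ℚ) + 1 = s + t := by exact_mod_cast ht
      have h5 : -((N : ℚ) + 2) + s = -1 * (t + 1) := by linear_combination -h4
      have h6 : (N + 1).choose t = (N + 1).choose s := by
        rw [← h1, Nat.choose_symm hs']
      simp only [Nat.succ_eq_add_one, h1, h2, h3, h5, h6, mul_pow, zsmul_eq_mul, nsmul_eq_mul]
      push_cast
      -- For `t = 0` the exponent `t - 1` truncates to 0, which is harmless because the base is 1.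
      rcases t.eq_zero_or_pos with rfl | htpos
      · simp
        ring
      · have : N = s + (t - 1) := by omega
        rw [this, pow_add, mul_one, add_comm (1 : ℚ)]
        ring

theorem Finset.sum_antidiagonal_antidiagonal {M : Type*} [AddCommMonoid M] (n : ℕ)
    (f : ℕ → ℕ → ℕ → M) :
    ∑ p ∈ antidiagonal n, ∑ q ∈ antidiagonal p.1, f q.1 q.2 p.2 =
      ∑ p ∈ antidiagonal n, ∑ q ∈ antidiagonal p.2, f p.1 q.1 q.2 := by
  rw [sum_sigma', sum_sigma']
  refine sum_nbij' (fun x => ⟨(x.2.1, x.2.2 + x.1.2), (x.2.2, x.1.2)⟩)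
    (fun x => ⟨(x.1.1 + x.2.1, x.2.2), (x.1.1, x.2.1)⟩) ?_ ?_ ?_ ?_ ?_
  · rintro ⟨⟨s, t⟩, j, u⟩ h
    simp only [mem_sigma, HasAntidiagonal.mem_antidiagonal] at h ⊢
    exact ⟨by omega, trivial⟩
  · rintro ⟨⟨s, t⟩, j, u⟩ h
    simp only [mem_sigma, HasAntidiagonal.mem_antidiagonal] at h ⊢
    exact ⟨by omega, trivial⟩
  · rintro ⟨⟨s, t⟩, j, u⟩ h
    simp only [mem_sigma, HasAntidiagonal.mem_antidiagonal] at h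
    rw [← h.2]
  · rintro ⟨⟨s, t⟩, j, u⟩ h
    simp only [mem_sigma, HasAntidiagonal.mem_antidiagonal] at h
    rw [← h.2]
  · intros
    rfl

/-- The binomial identity of Abel for natural numbers. -/
theorem Nat.sum_antidiagonal_choose_mul_pow (N y : ℕ) :
    ∑ p ∈ antidiagonal N, N.choose p.1 * (y + p.1) ^ p.1 * (p.2 + 1) ^ (p.2 - 1) =
      (y + 1 + N) ^ N := by
  exact_mod_cast _root_.sum_antidiagonal_choose_mul_pow N y

/-! ### Cayley's formula and the closed form -/

namespace ParentMap

section ClosedForm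

theorem recordSum_one {R : Type*} [CommSemiring R] (V : Type*) [Finite V] [LinearOrder V] :
    recordSum V (1 : R) = (Fintype.card (ParentMap V) : R) := by
  simp [recordSum]

theorem add_one_pow_pred_mul (s : ℕ) : (s + 1) ^ (s - 1) * (s + 1) = (s + 1) ^ s := by
  cases s with
  | zero => rfl
  | succ s => rw [Nat.add_sub_cancel, ← pow_succ]

/-- Cayley's formula for rooted forests. -/
theorem card_fin (n : ℕ) : Fintype.card (ParentMap (Fin n)) = (n + 1) ^ (n - 1) := by
  induction n using Nat.strong_induction_on with
  | _ n ih =>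
    cases n with
    | zero =>
      have h := recordSum_fin_zero (1 : ℕ)
      rwa [recordSum_one, Nat.cast_id] at h
    | succ n =>
      have h := recordSum_fin_succ n (1 : ℕ)
      simp only [recordSum_one, Nat.cast_id, one_mul] at h
      -- Abel's identity with y = 1: the factor s + 1 of the recursion turns (s+1)^(s-1) into
      -- (s+1)^s.
      rw [h, Nat.add_sub_cancel, show n + 1 + 1 = 1 + 1 + n by ring,
        ← Nat.sum_antidiagonal_choose_mul_pow]
      refine sum_congr rfl fun p hp => ?_
      have hp' := mem_antidiagonal.1 hp
      rw [ih p.1 (by omega), ih p.2 (by omega), add_comm 1 p.1, ← add_one_pow_pred_mul]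
      ring

variable {R : Type*} [CommRing R]

/-- Since (j+1) x P_j = P_{j+1} + P_j, comparing the coefficients of P_j reduces the claim to (j+1)
C(n+1,j) = C(n,j) + (n+2) C(n,j-1). -/
theorem sum_antidiagonal_mul_prod (n : ℕ) (x : R) :
    ((n + 2 : ℕ) : R) * ∑ p ∈ antidiagonal n, ((n.choose p.1 * (p.1 + 1) * (n + 2) ^ p.2 : ℕ) : R) *
        (x * ∏ i ∈ range p.1, (((i : R) + 1) * x - 1)) =
      ∑ p ∈ antidiagonal (n + 1), (((n + 1).choose p.1 * (p.1 + 1) * (n + 2) ^ p.2 : ℕ) : R) *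
        ∏ i ∈ range p.1, (((i : R) + 1) * x - 1) := by
  have hsplit : ∑ p ∈ antidiagonal (n + 1),
        (((n + 1).choose p.1 * (p.1 + 1) * (n + 2) ^ p.2 : ℕ) : R) *
          ∏ i ∈ range p.1, (((i : R) + 1) * x - 1) =
      (∑ p ∈ antidiagonal (n + 1), ((n.choose p.1 * (n + 2) ^ p.2 : ℕ) : R) *
          ∏ i ∈ range p.1, (((i : R) + 1) * x - 1)) +
      ∑ p ∈ antidiagonal (n + 1),
        (((n + 1).choose p.1 : R) * (p.1 + 1) - n.choose p.1) * ((n + 2 : ℕ) : R) ^ p.2 *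
          ∏ i ∈ range p.1, (((i : R) + 1) * x - 1) := by
    rw [← sum_add_distrib]
    refine sum_congr rfl fun p _ => ?_
    push_cast
    ring
  -- The first sum loses its term j = n + 1, the second its term j = 0; the second, reindexed,
  -- carries the P_{j+1}.
  rw [hsplit, Nat.sum_antidiagonal_succ', Nat.sum_antidiagonal_succ]
  simp only [Nat.choose_succ_self, zero_mul, Nat.cast_zero, zero_add, Nat.choose_zero_right,
    Nat.cast_one, one_mul, sub_self]
  rw [mul_sum, ← sum_add_distrib]
  refine sum_congr rfl fun p _ => ?_
  have hc : ((n + 1).choose (p.1 + 1) : R) * (p.1 + 1 + 1) =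
      n.choose (p.1 + 1) + (n + 2) * n.choose p.1 := by
    have h1 : ((n + 1).choose (p.1 + 1) : R) = n.choose p.1 + n.choose (p.1 + 1) := by
      rw [Nat.choose_succ_succ, Nat.cast_add]
    have h2 : ((n : R) + 1) * n.choose p.1 = (n + 1).choose (p.1 + 1) * (p.1 + 1) := by
      have := congrArg (Nat.cast : ℕ → R) (Nat.add_one_mul_choose_eq n p.1)
      push_cast at this
      exact this
    linear_combination h1 - h2
  rw [prod_range_succ]
  push_cast
  rw [hc]
  ring

/-- The closed form of the generating function of records. -/
theorem recordSum_fin (n : ℕ) (x : R) :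
    ((n + 1 : ℕ) : R) * recordSum (Fin n) x =
      ∑ p ∈ antidiagonal n, ((n.choose p.1 * (p.1 + 1) * (n + 1) ^ p.2 : ℕ) : R) *
        ∏ i ∈ range p.1, (((i : R) + 1) * x - 1) := by
  induction n using Nat.strong_induction_on with
  | _ n ih =>
    cases n with
    | zero => simp [recordSum_fin_zero]
    | succ n =>
      rw [← sum_antidiagonal_mul_prod, recordSum_fin_succ]
      congr 1
      have h1 : ∀ p ∈ antidiagonal n, (n.choose p.1 : R) *
          (x * (recordSum (Fin p.1) x * recordSum (Fin p.2) (1 : R) * ((p.1 : R) + 1))) =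
          ∑ q ∈ antidiagonal p.1,
            ((n.choose (q.1 + q.2) * (q.1 + q.2).choose q.1 * (q.1 + 1) * (q.1 + q.2 + 1) ^ q.2 *
              (p.2 + 1) ^ (p.2 - 1) : ℕ) : R) *
              (x * ∏ i ∈ range q.1, (((i : R) + 1) * x - 1)) := by
        intro p hp
        have hp' := mem_antidiagonal.1 hp
        have hF := ih p.1 (by omega)
        rw [recordSum_one, card_fin]
        calc _ = (n.choose p.1 : R) * x * (((p.2 + 1) ^ (p.2 - 1) : ℕ) : R) *
              (((p.1 + 1 : ℕ) : R) * recordSum (Fin p.1) x) := by push_cast; ring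
          _ = _ := by
            rw [hF, mul_sum]
            refine sum_congr rfl fun q hq => ?_
            rw [mem_antidiagonal.1 hq]
            push_cast
            ring
      -- The factor s + 1 of the recursion is the one in the induction hypothesis. With j outermost,
      -- the inner sum is Abel's with N = n - j and y = j + 1, equal to (n+2)^(n-j).
      rw [sum_congr rfl h1, sum_antidiagonal_antidiagonal n fun j u t =>
        ((n.choose (j + u) * (j + u).choose j * (j + 1) * (j + u + 1) ^ u *
          (t + 1) ^ (t - 1) : ℕ) : R) * (x * ∏ i ∈ range j, (((i : R) + 1) * x - 1))]
      refine sum_congr rfl fun p hp => ?_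
      have hp' := mem_antidiagonal.1 hp
      rw [← sum_mul, ← Nat.cast_sum]
      congr 2
      have hA := Nat.sum_antidiagonal_choose_mul_pow p.2 (p.1 + 1)
      rw [show n + 2 = p.1 + 1 + 1 + p.2 by omega, ← hA, mul_sum]
      refine sum_congr rfl fun q hq => ?_
      have hq' := mem_antidiagonal.1 hq
      have hc : n.choose (p.1 + q.1) * (p.1 + q.1).choose p.1 = n.choose p.1 * p.2.choose q.1 := by
        rw [Nat.choose_mul (by omega)]
        congr 2 <;> omega
      rw [hc, add_right_comm p.1 q.1 1]
      ring

end ClosedForm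

/-! ### Stirling coefficients and the final formula -/

/-- Multiplication by (j+1)X - 1 acts on coefficients, up to sign, as the recurrence c(j+2, r+1) =
(j+1) c(j+1, r+1) + c(j+1, r). -/
theorem coeff_prod (j k : ℕ) :
    (∏ i ∈ range j, (((i : ℚ[X]) + 1) * X - 1)).coeff k =
      (-1) ^ (j + k) * (Nat.stirlingFirst (j + 1) (j + 1 - k) : ℚ) := by
  induction j generalizing k with
  | zero => rcases k with _ | k <;> simp [Polynomial.coeff_one, Nat.stirlingFirst]
  | succ j ih =>
    have h (P : Polynomial ℚ) : P * (((j : Polynomial ℚ) + 1) * Polynomial.X - 1) =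
        ((j + 1 : ℕ) : Polynomial ℚ) * (P * Polynomial.X) - P := by push_cast; ring
    rw [prod_range_succ, h, Polynomial.coeff_sub, Polynomial.coeff_natCast_mul, ih]
    rcases k with _ | k
    · rw [Polynomial.coeff_mul_X_zero]
      simp [Nat.stirlingFirst_self, pow_succ]
    · rw [Polynomial.coeff_mul_X, ih]
      -- For `j < k` all the truncated differences are 0, and c(·, 0) vanishes at positive first
      -- argument.
      rcases lt_or_ge j k with hk | hk
      · rw [show j + 1 - k = 0 by omega, show j + 1 - (k + 1) = 0 by omega,
          show j + 1 + 1 - (k + 1) = 0 by omega]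
        simp
      · rw [show j + 1 + 1 - (k + 1) = j - k + 1 by omega, show j + 1 - (k + 1) = j - k by omega,
          show j + 1 - k = j - k + 1 by omega, Nat.stirlingFirst_succ_succ (j + 1)]
        push_cast
        ring

theorem coeff_recordSum (n k : ℕ) :
    (recordSum (Fin n) (Polynomial.X : Polynomial ℚ)).coeff k = (forestRecordNumber n k : ℚ) := by
  have hcard : forestRecordNumber n k = Nat.card {f : ParentMap (Fin n) // f.numRecords = k} :=
    Nat.card_congr (Equiv.subtypeEquiv
      (Equiv.ofBijective toRootedForest ⟨toRootedForest_injective, toRootedForest_surjective⟩)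
      fun f => (numRecords_toRootedForest f).symm ▸ Iff.rfl).symm
  rw [hcard, recordSum, Polynomial.finsetSum_coeff, Nat.card_eq_fintype_card, Fintype.card_subtype]
  simp [Polynomial.coeff_X_pow, eq_comm]

end ParentMap

theorem mainTheorem2 (n k : ℕ) :
    (forestRecordNumber n k : ℚ) =
      ∑ m ∈ Finset.Icc (k + 1) (n + 1),
        (-1 : ℚ) ^ (m + k - 1) * (n.choose (m - 1) : ℚ) * (m : ℚ) *
          ((n : ℚ) + 1) ^ ((n : ℤ) - (m : ℤ)) * (Nat.stirlingFirst m (m - k) : ℚ) := by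
  have hn : (n : ℚ) + 1 ≠ 0 := by positivity
  have h := congrArg (Polynomial.coeff · k) (ParentMap.recordSum_fin n (Polynomial.X : Polynomial ℚ))
  simp only [Polynomial.finsetSum_coeff, Polynomial.coeff_natCast_mul, ParentMap.coeff_recordSum,
    ParentMap.coeff_prod] at h
  rw [Nat.sum_antidiagonal_eq_sum_range_succ_mk] at h
  refine mul_left_cancel₀ hn ?_
  rw [← Nat.cast_succ, Nat.succ_eq_add_one, h, mul_sum]
  have hIcc : Finset.Icc (k + 1) (n + 1) = (Finset.Icc k n).map (addRightEmbedding 1) := by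
    rw [Finset.map_add_right_Icc]
  rw [hIcc, sum_map]
  symm
  -- The closed form also has terms with j < k; they vanish since `j + 1 - k` truncates to 0 and
  -- c(j+1, 0) = 0.
  refine (sum_subset_zero_on_sdiff (fun j hj => ?_) (fun j hj => ?_) fun j hj => ?_)
  · rw [mem_range]; have := mem_Icc.1 hj; omega
  · rw [mem_sdiff, mem_range, mem_Icc] at hj
    have : j + 1 - k = 0 := by omega
    simp [this]
  · have hj' := mem_Icc.1 hj
    have hpow : ((n : ℚ) + 1) * (n + 1) ^ ((n : ℤ) - ((j + 1 : ℕ) : ℤ)) = (n + 1) ^ (n - j) := by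
      rw [← zpow_one_add₀ hn, ← zpow_natCast]
      congr 1
      push_cast [hj'.2]
      ring
    rw [addRightEmbedding_apply, Nat.add_sub_cancel, show j + 1 + k - 1 = j + k by omega]
    push_cast at hpow ⊢
    rw [← hpow]
    ring
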